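/- **Definitions.** Let $w$ be a word over the alphabet $\Sigma=\{1,\dots,n\}$. Two distinct symbols $x,y$ *alternate* in $w$ if the subsequence $\pi_{\{x,y\}}(w)$ of all occurrences of $x$ and $y$ in $w$ is one of $(xy)^k,\ (xy)^kx,\ (yx)^k,\ (yx)^ky$ with $k\ge 0$. The graph $G(w)$ has vertices $v_1,\dots,v_n$ and an edge $(v_x,v_y)$ iff $x \ne y$ alternate in $w$. Split $w$, reading from left to right, into *timestep factors*: a new factor starts exactly at each position whose symbol already occurs in the current factor. The temporal graph $TG(w)=(V,E_1,\dots,E_T)$ has one timestep per factor, and $E_t$ consists of the edges $(v_x,v_y)$ of $G(w)$ such that $x$ or $y$ occurs in the $t$-th factor. Its underlying graph is $(V,\bigcup_t E_t)$. A *temporal walk* is a sequence $(e_1,t_1),\dots,(e_k,t_k)$ with $e_i\in E_{t_i}$, the end point of $e_i$ equal to the start point of $e_{i+1}$, and $t_1<\dots<t_k$; it starts at the start point of $e_1$ and requires $t_k$ timesteps. It is an *exploration* if every vertex lies on one of its edges. **Theorem.** There is an absolute constant $c>0$ such that for all integers $n,d$ with $1\le d<n$ there is a word $v$ over $\{1,\dots,n\}$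 in which every symbol occurs, so that $TG(v)$ has $n$ vertices, with the following properties: 1. the underlying graph of $TG(v)$ is connected and has diameter exactly $d$; 2. $TG(v)$ has an exploration from every start vertex; 3. every exploration of $TG(v)$, from any start vertex, requires at least $c\,d\,n$ timesteps; 4. if $d\ge 2$, the vertex set is partitioned into $d+1$ layers $L_0,\dots,L_d$, each of size $\lfloor n/(d+1)\rfloor$ or $\lfloor n/(d+1)\rfloor+1$, such that two vertices are adjacent in the underlying graph iff they lie in consecutive layers. -/

import Mathlib

namespace WordTemporal

/-- The word `w ^ k`: the concatenation of `k` copies of `w`. -/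
def wordPow {α : Type*} (w : List α) (k : ℕ) : List α :=
  (List.replicate k w).flatten

/-- The projection `π_S(w)`: the longest subsequence of `w` that uses only symbols of `S`. -/
def proj {α : Type*} [DecidableEq α] (S : Finset α) (w : List α) : List α :=
  w.filter (fun a => a ∈ S)

/-- The symbols `x` and `y` alternate in `w`:
`π_{x,y}(w)` is one of `(xy)^k`, `(xy)^k x`, `(yx)^k`, `(yx)^k y` for some `k ≥ 0`. -/
def Alternate {α : Type*} [DecidableEq α] (w : List α) (x y : α) : Prop :=
  ∃ k : ℕ,
    proj {x, y} w = wordPow [x, y] k ∨ proj {x, y} w = wordPow [x, y] k ++ [x] ∨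
    proj {x, y} w = wordPow [y, x] k ∨ proj {x, y} w = wordPow [y, x] k ++ [y]

theorem Alternate.symm {α : Type*} [DecidableEq α] {w : List α} {x y : α}
    (h : Alternate w x y) : Alternate w y x := by
  obtain ⟨k, h⟩ := h
  refine ⟨k, ?_⟩
  rw [Finset.pair_comm y x]
  tauto

/-- The graph `G(w)` represented by the word `w`; its vertices are the symbols of the alphabet. -/
def wordGraph {α : Type*} [DecidableEq α] (w : List α) : SimpleGraph α where
  Adj x y := x ≠ y ∧ Alternate w x y
  symm := ⟨fun _ _ h => ⟨h.1.symm, h.2.symm⟩⟩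
  loopless := ⟨fun _ h => h.1 rfl⟩

/-- A temporal graph on the vertex set `V`. The timesteps are numbered `1, …, lifetime`;
timestep `i + 1` is `step i`. -/
structure TemporalGraph (V : Type*) where
  lifetime : ℕ
  step : Fin lifetime → SimpleGraph V

namespace TemporalGraph

/-- The edge `(x, y)` is active in timestep `t`, where `1 ≤ t ≤ lifetime`. -/
def Active {V : Type*} (𝒢 : TemporalGraph V) (t : ℕ) (x y : V) : Prop :=
  ∃ i : Fin 𝒢.lifetime, t = (i : ℕ) + 1 ∧ (𝒢.step i).Adj x y

/-- The underlying graph: the union of all timesteps. -/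
def underlying {V : Type*} (𝒢 : TemporalGraph V) : SimpleGraph V :=
  ⨆ i : Fin 𝒢.lifetime, 𝒢.step i

end TemporalGraph

/-- Auxiliary to `timestepFactors`: `cur` is the part of the current factor that has been read. -/
def timestepFactorsAux {α : Type*} [DecidableEq α] : List α → List α → List (List α)
  | cur, [] => [cur]
  | cur, a :: w =>
    if a ∈ cur then cur :: timestepFactorsAux [a] w
    else timestepFactorsAux (cur ++ [a]) w

/-- The timestep factors of `w`. Reading `w` from left to right, a new factor starts
exactly at those positions whose symbol already occurs in the current factor. -/
def timestepFactors {α : Type*} [DecidableEq α] : List α → List (List α)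
  | [] => []
  | a :: w => timestepFactorsAux [a] w

/-- The temporal graph `TG(w)` represented by the word `w`: there is one timestep for each
timestep factor, and an edge of `G(w)` is active in it iff at least one of its two end points
occurs in the factor. -/
def TG {α : Type*} [DecidableEq α] (w : List α) : TemporalGraph α where
  lifetime := (timestepFactors w).length
  step i :=
    { Adj := fun x y => (wordGraph w).Adj x y ∧
        (x ∈ (timestepFactors w).get i ∨ y ∈ (timestepFactors w).get i)
      symm := ⟨fun _ _ h => ⟨h.1.symm, h.2.symm⟩⟩
      loopless := ⟨fun _ h => h.1.ne rfl⟩ }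

/-- One step of a temporal walk: an edge with its start point and end point, and the timestep
in which it is traversed. -/
structure WalkStep (V : Type*) where
  src : V
  dst : V
  time : ℕ

/-- A temporal walk: every edge is active in the timestep in which it is traversed, consecutive
edges are connected, and the timesteps strictly increase. -/
def IsTemporalWalk {V : Type*} (𝒢 : TemporalGraph V) (P : List (WalkStep V)) : Prop :=
  (∀ s ∈ P, 𝒢.Active s.time s.src s.dst) ∧
  P.IsChain (fun s s' => s.dst = s'.src ∧ s.time < s'.time)

/-- The number of timesteps that a temporal walk requires: the timestep of its last edge. -/
def walkTime {V : Type*} (P : List (WalkStep V)) : ℕ :=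
  (P.getLast?.map WalkStep.time).getD 0

/-- `P` is an exploration of `𝒢` from `u`: a temporal walk whose first edge has start point `u`
and which visits every vertex. -/
def IsExploration {V : Type*} (𝒢 : TemporalGraph V) (u : V) (P : List (WalkStep V)) : Prop :=
  IsTemporalWalk 𝒢 P ∧ P.head?.map WalkStep.src = some u ∧
  ∀ x : V, ∃ s ∈ P, x = s.src ∨ x = s.dst

end WordTemporal

/-!
A connected layered graph with layers `F₀, …, F_d` is represented by the word that sweeps through
the layers and lists each of them twice, the second time reversed, with one appearance of each
neighbouring layer in between: symbols of consecutive layers then occur as `xyxy`, while the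
projection to any other two symbols contains some `l lᴿ`, in which a symbol is repeated. Repeating
the sweep sufficiently often leaves room to walk anywhere, one edge per sweep.

Except where two sweeps meet, the timestep factors contain four layers each and move up by two
layers per timestep, while a temporal walk moves up by at most one layer. Hence a walk leaves the
active layers after boundedly many edges and has to wait for the next sweep. So it uses `O(1)` edges
in the `≥ d / 2` timesteps of a sweep, whereas an exploration uses at least `n - 1` edges. For
`d = 1`, repeating a permutation gives the complete graph, and a walk uses at most one edge per
timestep.
-/

namespace WordTemporal

section Words

variable {α β : Type*}

theorem wordPow_succ (w : List β) (k : ℕ) : wordPow w (k + 1) = w ++ wordPow w k := by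
  simp only [wordPow, List.replicate_succ, List.flatten_cons]

theorem wordPow_wordPow (w : List β) (j k : ℕ) : wordPow (wordPow w j) k = wordPow w (k * j) := by
  induction k with
  | zero => simp [wordPow]
  | succ k ih =>
    rw [wordPow_succ, ih, Nat.succ_mul, Nat.add_comm]
    simp only [wordPow, List.replicate_add, List.flatten_append]

theorem flatten_wordPow (Q : List (List β)) (k : ℕ) :
    (wordPow Q k).flatten = wordPow Q.flatten k := by
  induction k with
  | zero => rfl
  | succ k ih => rw [wordPow_succ, wordPow_succ, List.flatten_append, ih]

theorem append_infix_wordPow_append (s t : List β) {k : ℕ} (hk : 2 ≤ k) :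
    s ++ t <:+: wordPow (t ++ s) k := by
  obtain ⟨k, rfl⟩ := Nat.exists_eq_add_of_le' hk
  exact ⟨t, s ++ wordPow (t ++ s) k, by simp only [wordPow_succ, List.append_assoc]⟩

theorem append_eq_or_of_append_eq {s t : List β} {x y : β} (h : s ++ t = [x, y, x, y]) :
    t ++ s = [x, y, x, y] ∨ t ++ s = [y, x, y, x] := by
  rcases s with _ | ⟨a, _ | ⟨b, _ | ⟨c, _ | ⟨d, s⟩⟩⟩⟩ <;> simp_all

theorem length_wordPow (w : List β) (k : ℕ) : (wordPow w k).length = k * w.length := by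
  simp [wordPow]

theorem mem_wordPow {w : List β} {k : ℕ} (hk : k ≠ 0) {a : β} : a ∈ wordPow w k ↔ a ∈ w := by
  simp [wordPow, hk]

theorem getElem?_wordPow (w : List β) {k i : ℕ} (hi : i < k * w.length) :
    (wordPow w k)[i]? = w[i % w.length]? := by
  induction k generalizing i with
  | zero => omega
  | succ k ih =>
    rw [Nat.succ_mul] at hi
    rw [wordPow_succ]
    rcases lt_or_ge i w.length with h | h
    · rw [List.getElem?_append_left h, Nat.mod_eq_of_lt h]
    · rw [List.getElem?_append_right h, ih (by omega), Nat.mod_eq_sub_mod h]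

theorem isChain_wordPow {R : β → β → Prop} {w : List β} (hw : w.IsChain R)
    (hwrap : ∀ a ∈ w.getLast?, ∀ b ∈ w.head?, R a b) (k : ℕ) : (wordPow w k).IsChain R := by
  induction k with
  | zero => exact .nil
  | succ k ih =>
    rw [wordPow_succ, List.isChain_append]
    refine ⟨hw, ih, fun a ha b hb => hwrap a ha b ?_⟩
    rcases eq_or_ne k 0 with rfl | hk
    · simp [wordPow] at hb
    · rwa [wordPow, List.head?_flatten_replicate hk] at hb

theorem not_isChain_ne_append_reverse {l : List β} (hl : l ≠ []) :
    ¬ (l ++ l.reverse).IsChain (· ≠ ·) := by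
  intro h
  have hlast := List.getLast?_eq_some_getLast hl
  exact (List.isChain_append.1 h).2.2 _ hlast _ (by rwa [List.head?_reverse]) rfl

variable [DecidableEq α]

theorem proj_append (S : Finset α) (u w : List α) : proj S (u ++ w) = proj S u ++ proj S w :=
  List.filter_append ..

theorem proj_reverse (S : Finset α) (w : List α) : proj S w.reverse = (proj S w).reverse :=
  List.filter_reverse ..

theorem proj_wordPow (S : Finset α) (w : List α) (k : ℕ) :
    proj S (wordPow w k) = wordPow (proj S w) k := by
  induction k with
  | zero => rfl
  | succ k ih => rw [wordPow_succ, wordPow_succ, proj_append, ih]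

theorem proj_infix (S : Finset α) {u w : List α} (h : u <:+: w) : proj S u <:+: proj S w :=
  h.filter _

theorem proj_pair_eq_nil {w : List α} {x y : α} (hx : x ∉ w) (hy : y ∉ w) :
    proj {x, y} w = [] := by
  rw [proj, List.filter_eq_nil_iff]
  grind

theorem proj_pair_eq_singleton {w : List α} {x y : α} (hw : w.Nodup) (hx : x ∈ w) (hy : y ∉ w) :
    proj {x, y} w = [x] := by
  refine List.perm_singleton.1 ((List.perm_ext_iff_of_nodup (hw.filter _) (by simp)).2 fun a => ?_)
  grind [proj]

theorem proj_pair_eq_or {w : List α} {x y : α} (hxy : x ≠ y) (hw : w.Nodup) (hx : x ∈ w)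
    (hy : y ∈ w) : proj {x, y} w = [x, y] ∨ proj {x, y} w = [y, x] := by
  refine List.perm_pair.1 ((List.perm_ext_iff_of_nodup (hw.filter _) (by simpa)).2 fun a => ?_)
  grind [proj]

theorem Alternate.isChain_proj {w : List α} {x y : α} (hxy : x ≠ y) (h : Alternate w x y) :
    (proj {x, y} w).IsChain (· ≠ ·) := by
  have hpow {a b : α} (hab : a ≠ b) (k : ℕ) : (wordPow [a, b] k).IsChain (· ≠ ·) :=
    isChain_wordPow (by simpa) (by simpa using hab.symm) k
  have hprefix (a b : α) (k : ℕ) : wordPow [a, b] k ++ [a] <+: wordPow [a, b] (k + 1) := by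
    simp [wordPow, List.replicate_succ']
  obtain ⟨k, h | h | h | h⟩ := h <;> rw [h]
  · exact hpow hxy k
  · exact (hpow hxy (k + 1)).prefix (hprefix x y k)
  · exact hpow hxy.symm k
  · exact (hpow hxy.symm (k + 1)).prefix (hprefix y x k)

theorem alternate_wordPow {w : List α} {x y : α} {j : ℕ}
    (h : proj {x, y} w = wordPow [x, y] j ∨ proj {x, y} w = wordPow [y, x] j) (k : ℕ) :
    Alternate (wordPow w k) x y := by
  refine ⟨k * j, ?_⟩
  rw [proj_wordPow]
  rcases h with h | h <;> simp only [h, wordPow_wordPow, true_or, or_true]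

theorem not_alternate_of_append_reverse_infix {w l : List α} {x y : α} (hxy : x ≠ y) (hl : l ≠ [])
    (h : l ++ l.reverse <:+: proj {x, y} w) : ¬ Alternate w x y :=
  fun hw => not_isChain_ne_append_reverse hl ((hw.isChain_proj hxy).infix h)

end Words

section Sweep

variable {α : Type*}

/-- The word `F₀ · F₁ F₀ᴿ · F₂ F₁ᴿ ⋯ Fₖ Fₖ₋₁ᴿ` which runs once through the layers `F₀, …, Fₖ`. Every
layer but the last appears twice, the second time reversed, and the two appearances of a layer are
separated by exactly one appearance of each neighbouring layer. -/
def sweep (F : ℕ → List α) : ℕ → List α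
  | 0 => F 0
  | k + 1 => sweep F k ++ F (k + 1) ++ (F k).reverse

theorem sweep_prefix (F : ℕ → List α) {j k : ℕ} (h : j ≤ k) : sweep F j <+: sweep F k := by
  induction k, h using Nat.le_induction with
  | base => exact List.prefix_rfl
  | succ k _ ih => exact ih.trans ⟨F (k + 1) ++ (F k).reverse, (List.append_assoc ..).symm⟩

theorem subset_sweep (F : ℕ → List α) {j k : ℕ} (h : j ≤ k) : F j ⊆ sweep F k := by
  refine List.Subset.trans ?_ (sweep_prefix F h).subset
  cases j <;> simp [sweep]

theorem suffix_sweep (F : ℕ → List α) {k : ℕ} (h : ∀ j, j + 1 = k → F j = []) :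
    F k <:+ sweep F k := by
  cases k with
  | zero => exact List.suffix_rfl
  | succ k => exact ⟨sweep F k, by simp [sweep, h k rfl]⟩

theorem append_reverse_infix_sweep {F : ℕ → List α} {i k : ℕ} (hpred : ∀ j, j + 1 = i → F j = [])
    (hsucc : F (i + 1) = []) (hik : i < k) : F i ++ (F i).reverse <:+: sweep F k := by
  obtain ⟨s, hs⟩ := suffix_sweep F hpred
  have h : F i ++ (F i).reverse <:+: sweep F (i + 1) := ⟨s, [], by simp [sweep, ← hs, hsucc]⟩
  exact h.trans (sweep_prefix F hik).isInfix

theorem sweep_eq_nil {F : ℕ → List α} {k : ℕ} (h : ∀ j ≤ k, F j = []) : sweep F k = [] := by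
  induction k with
  | zero => exact h 0 le_rfl
  | succ k ih =>
    simp [sweep, ih fun j hj => h j (hj.trans k.le_succ), h (k + 1) le_rfl, h k k.le_succ]

theorem sweep_eq_self {F : ℕ → List α} {k : ℕ} (h : ∀ j < k, F j = []) : sweep F k = F k := by
  cases k with
  | zero => rfl
  | succ k => simp [sweep, sweep_eq_nil fun j (hj : j ≤ k) => h j (by omega), h k (by omega)]

theorem sweep_pair {F : ℕ → List α} {x y : α} {i k : ℕ} (hx : F i = [x]) (hy : F (i + 1) = [y])
    (hF : ∀ j, j ≠ i → j ≠ i + 1 → F j = []) (hik : i + 2 ≤ k) : sweep F k = [x, y, x, y] := by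
  have hi : sweep F i = [x] := by rw [sweep_eq_self fun j hj => hF j (by omega) (by omega), hx]
  induction k, hik using Nat.le_induction with
  | base => simp [sweep, hi, hx, hy, hF (i + 2) (by omega) (by omega)]
  | succ k hik ih =>
    simp [sweep, ih, hF k (by omega) (by omega), hF (k + 1) (by omega) (by omega)]

theorem proj_sweep [DecidableEq α] (S : Finset α) (F : ℕ → List α) (k : ℕ) :
    proj S (sweep F k) = sweep (fun j => proj S (F j)) k := by
  induction k with
  | zero => rfl
  | succ k ih => simp only [sweep, proj_append, proj_reverse, ih]

/-- The timestep factor `F₂ₖᴿ F₂ₖ₊₂ F₂ₖ₊₁ᴿ F₂ₖ₊₃` of a sweep. -/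
def sweepBlock (F : ℕ → List α) (k : ℕ) : List α :=
  (F (2 * k)).reverse ++ F (2 * k + 2) ++ (F (2 * k + 1)).reverse ++ F (2 * k + 3)

theorem sweep_append_eq_flatMap_sweepBlock (F : ℕ → List α) (k : ℕ) :
    sweep F (2 * k) ++ F (2 * k + 1) = F 0 ++ F 1 ++ (List.range k).flatMap (sweepBlock F) := by
  induction k with
  | zero => simp [sweep]
  | succ k ih =>
    rw [List.range_succ, List.flatMap_append, ← List.append_assoc, ← ih]
    simp [sweep, sweepBlock, Nat.mul_succ]

/-- The timestep factors of one period of the word that repeats `sweep F (2 * m + 2)`. The end of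
one sweep and the beginning of the next one share a timestep factor, which is put first here; so
`(sweepFactors F m).flatten` is a rotation of the sweep. -/
def sweepFactors (F : ℕ → List α) (m : ℕ) : List (List α) :=
  (sweepBlock F m ++ (F 0 ++ F 1)) :: (List.range m).map (sweepBlock F)

theorem exists_sweep_rotation {F : ℕ → List α} {m : ℕ} (h : F (2 * m + 3) = []) :
    ∃ s t, sweep F (2 * m + 2) = s ++ t ∧ (sweepFactors F m).flatten = t ++ s := by
  refine ⟨F 0 ++ F 1 ++ (List.range m).flatMap (sweepBlock F), sweepBlock F m, ?_, ?_⟩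
  · rw [← sweep_append_eq_flatMap_sweepBlock]
    simp [sweep, sweepBlock, h]
  · simp [sweepFactors, List.flatMap_def]

end Sweep

section LayeredWord

variable {α : Type*}

/-- The graph in which two vertices are adjacent iff `f` puts them into consecutive layers. -/
def layeredGraph (f : α → ℕ) : SimpleGraph α :=
  (SimpleGraph.hasse ℕ).comap f

theorem layeredGraph_adj {f : α → ℕ} {x y : α} :
    (layeredGraph f).Adj x y ↔ f x + 1 = f y ∨ f y + 1 = f x := by
  simp [layeredGraph, SimpleGraph.hasse_adj, Nat.covBy_iff_add_one_eq]

variable [Fintype α]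

/-- The word which lists the layer `f = j`, in an arbitrary order. -/
noncomputable def layerList (f : α → ℕ) (j : ℕ) : List α :=
  (Finset.univ.filter fun x => f x = j).toList

theorem mem_layerList {f : α → ℕ} {j : ℕ} {x : α} : x ∈ layerList f j ↔ f x = j := by
  simp [layerList]

theorem nodup_layerList (f : α → ℕ) (j : ℕ) : (layerList f j).Nodup :=
  Finset.nodup_toList _

theorem layerList_eq_nil {f : α → ℕ} {j : ℕ} (h : ∀ x, f x ≠ j) : layerList f j = [] :=
  List.eq_nil_iff_forall_not_mem.2 fun x hx => h x (mem_layerList.1 hx)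

/-- A rotation of the sweep through the layers of `f`, which are numbered `0, …, 2 * m + 1`. -/
noncomputable def layerWord (f : α → ℕ) (m : ℕ) : List α :=
  (sweepFactors (layerList f) m).flatten

theorem exists_layerWord_rotation {f : α → ℕ} {m : ℕ} (hf : ∀ x, f x ≤ 2 * m + 1) :
    ∃ s t, sweep (layerList f) (2 * m + 2) = s ++ t ∧ layerWord f m = t ++ s :=
  exists_sweep_rotation (layerList_eq_nil fun x => by have := hf x; omega)

theorem mem_layerWord {f : α → ℕ} {m : ℕ} (hf : ∀ x, f x ≤ 2 * m + 1) (x : α) :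
    x ∈ layerWord f m := by
  obtain ⟨s, t, hst, hts⟩ := exists_layerWord_rotation hf
  have hx : x ∈ sweep (layerList f) (2 * m + 2) :=
    subset_sweep _ (Nat.le_succ_of_le (hf x)) (mem_layerList.2 rfl)
  rw [hst, List.mem_append] at hx
  exact hts ▸ List.mem_append.2 hx.symm

variable [DecidableEq α]

theorem proj_layerList_eq_nil {f : α → ℕ} {j : ℕ} {x y : α} (hx : f x ≠ j) (hy : f y ≠ j) :
    proj {x, y} (layerList f j) = [] :=
  proj_pair_eq_nil (mt mem_layerList.1 hx) (mt mem_layerList.1 hy)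

theorem proj_layerList_self_ne_nil (f : α → ℕ) (x y : α) :
    proj {x, y} (layerList f (f x)) ≠ [] :=
  List.ne_nil_of_mem (a := x) (by simp [proj, mem_layerList])

theorem proj_sweep_layerList {f : α → ℕ} {k : ℕ} {x y : α} (hxy : f x + 1 = f y)
    (hk : f y < k) : proj {x, y} (sweep (layerList f) k) = [x, y, x, y] := by
  rw [proj_sweep]
  refine sweep_pair (i := f x) ?_ ?_ (fun j hx hy => ?_) (by omega)
  · exact proj_pair_eq_singleton (nodup_layerList f _) (mem_layerList.2 rfl)
      (by rw [mem_layerList]; omega)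
  · rw [Finset.pair_comm, hxy]
    exact proj_pair_eq_singleton (nodup_layerList f _) (mem_layerList.2 rfl)
      (by rw [mem_layerList]; omega)
  · exact proj_layerList_eq_nil hx.symm (by omega)

theorem alternate_layerWord {f : α → ℕ} {m : ℕ} (hf : ∀ x, f x ≤ 2 * m + 1) {x y : α}
    (hxy : f x + 1 = f y) (K : ℕ) :
    Alternate (wordPow (layerWord f m) K) x y := by
  obtain ⟨s, t, hst, hts⟩ := exists_layerWord_rotation hf
  have hproj := proj_sweep_layerList hxy (Nat.lt_succ_of_le (hf y))
  rw [hst, proj_append] at hproj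
  refine alternate_wordPow (j := 2) ?_ K
  rw [hts, proj_append]
  exact append_eq_or_of_append_eq hproj

theorem not_alternate_layerWord {f : α → ℕ} {m : ℕ} (hf : ∀ x, f x ≤ 2 * m + 1) {x y : α}
    (hxy : x ≠ y) (h₁ : f x + 1 ≠ f y) (h₂ : f y + 1 ≠ f x) {K : ℕ} (hK : 2 ≤ K) :
    ¬ Alternate (wordPow (layerWord f m) K) x y := by
  obtain ⟨s, t, hst, hts⟩ := exists_layerWord_rotation hf
  have hsweep : sweep (layerList f) (2 * m + 2) <:+: wordPow (t ++ s) K :=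
    hst ▸ append_infix_wordPow_append s t hK
  have hproj := proj_infix {x, y} hsweep
  rw [proj_sweep] at hproj
  rw [hts]
  have hmirror := append_reverse_infix_sweep (F := fun j => proj {x, y} (layerList f j))
    (fun j hj => proj_layerList_eq_nil (by omega) (by omega))
    (proj_layerList_eq_nil (by omega) h₁.symm) (Nat.lt_succ_of_le (hf x))
  exact not_alternate_of_append_reverse_infix hxy (proj_layerList_self_ne_nil f x y)
    (hmirror.trans hproj)

theorem wordGraph_layerWord {f : α → ℕ} {m : ℕ} (hf : ∀ x, f x ≤ 2 * m + 1) {K : ℕ}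
    (hK : 2 ≤ K) :
    wordGraph (wordPow (layerWord f m) K) = layeredGraph f := by
  ext x y
  rw [layeredGraph_adj]
  constructor
  · rintro ⟨hxy, h⟩
    by_contra! hne
    exact not_alternate_layerWord hf hxy hne.1 hne.2 hK h
  · rintro (h | h)
    · exact ⟨ne_of_apply_ne f (by omega), alternate_layerWord hf h K⟩
    · exact ⟨ne_of_apply_ne f (by omega), (alternate_layerWord hf h K).symm⟩

end LayeredWord

section Factors

variable {α : Type*}

/-- The word `B` starts with a symbol of `A`: when the current timestep factor is `A`, reading `B`
starts a new one. -/
def ForcesBreak (A B : List α) : Prop :=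
  ∃ a ∈ A, B.head? = some a

/-- The words of `Q`, repeated cyclically, are the timestep factors of their concatenation. -/
structure IsFactorCycle (Q : List (List α)) : Prop where
  nodup : ∀ A ∈ Q, A.Nodup
  isChain : Q.IsChain ForcesBreak
  wrap : ∀ A ∈ Q.getLast?, ∀ B ∈ Q.head?, ForcesBreak A B

variable [DecidableEq α]

theorem timestepFactorsAux_append {cur B : List α} (h : (cur ++ B).Nodup) (w : List α) :
    timestepFactorsAux cur (B ++ w) = timestepFactorsAux (cur ++ B) w := by
  induction B generalizing cur with
  | nil => simp
  | cons b B ih =>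
    have hb : b ∉ cur := fun hb => (List.nodup_append.1 h).2.2 b hb b List.mem_cons_self rfl
    rw [List.append_cons] at h
    rw [List.cons_append, timestepFactorsAux, if_neg hb, ih h, ← List.append_cons]

theorem timestepFactorsAux_flatten {A : List α} {F : List (List α)}
    (hnodup : ∀ B ∈ F, B.Nodup) (hchain : (A :: F).IsChain ForcesBreak) :
    timestepFactorsAux A F.flatten = A :: F := by
  induction F generalizing A with
  | nil => rfl
  | cons B F ih =>
    obtain ⟨⟨a, ha, hhead⟩, hchain⟩ := List.isChain_cons_cons.1 hchain
    obtain ⟨hB, hF⟩ := List.forall_mem_cons.1 hnodup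
    obtain ⟨B, rfl⟩ := List.head?_eq_some_iff.1 hhead
    rw [List.flatten_cons, List.cons_append, timestepFactorsAux, if_pos ha,
      timestepFactorsAux_append hB, List.singleton_append, ih hF hchain]

theorem timestepFactors_flatten {F : List (List α)} (hhead : F.head? ≠ some [])
    (hnodup : ∀ A ∈ F, A.Nodup) (hchain : F.IsChain ForcesBreak) :
    timestepFactors F.flatten = F := by
  match F with
  | [] => rfl
  | [] :: _ => exact absurd rfl hhead
  | (a :: A) :: F =>
    obtain ⟨hA, hF⟩ := List.forall_mem_cons.1 hnodup
    rw [List.flatten_cons, List.cons_append, timestepFactors, timestepFactorsAux_append hA,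
      List.singleton_append, timestepFactorsAux_flatten hF hchain]

theorem flatten_timestepFactorsAux (cur w : List α) :
    (timestepFactorsAux cur w).flatten = cur ++ w := by
  induction w generalizing cur with
  | nil => simp [timestepFactorsAux]
  | cons a w ih =>
    rw [timestepFactorsAux]
    split <;> simp [ih]

theorem flatten_timestepFactors (w : List α) : (timestepFactors w).flatten = w := by
  cases w with
  | nil => rfl
  | cons a w => exact flatten_timestepFactorsAux [a] w

theorem IsFactorCycle.timestepFactors_wordPow {Q : List (List α)} (hQ : IsFactorCycle Q) (K : ℕ) :
    timestepFactors (wordPow Q.flatten K) = wordPow Q K := by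
  rcases eq_or_ne K 0 with rfl | hK
  · rfl
  rw [← flatten_wordPow]
  refine timestepFactors_flatten (fun h => ?_)
    (fun A hA => hQ.nodup A ((mem_wordPow hK).1 hA)) (isChain_wordPow hQ.isChain hQ.wrap K)
  rw [wordPow, List.head?_flatten_replicate hK] at h
  have hne : Q ≠ [] := by rintro rfl; simp at h
  obtain ⟨a, -, ha⟩ := hQ.wrap _ (List.getLast?_eq_some_getLast hne) _ h
  simp at ha

theorem active_TG_iff {w : List α} {t : ℕ} {x y : α} :
    (TG w).Active t x y ↔ (wordGraph w).Adj x y ∧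
      ∃ i A, t = i + 1 ∧ (timestepFactors w)[i]? = some A ∧ (x ∈ A ∨ y ∈ A) := by
  constructor
  · rintro ⟨i, rfl, hadj, hmem⟩
    exact ⟨hadj, i, _, rfl, List.getElem?_eq_getElem i.2, hmem⟩
  · rintro ⟨hadj, i, A, rfl, hA, hmem⟩
    obtain ⟨hi, rfl⟩ := List.getElem?_eq_some_iff.1 hA
    exact ⟨⟨i, hi⟩, rfl, hadj, hmem⟩

theorem underlying_TG {w : List α} (hw : ∀ x, x ∈ w) : (TG w).underlying = wordGraph w := by
  ext x y
  simp only [TemporalGraph.underlying, SimpleGraph.iSup_adj]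
  refine ⟨fun ⟨_, h⟩ => h.1, fun h => ?_⟩
  obtain ⟨A, hA, hx⟩ := List.mem_flatten.1 ((flatten_timestepFactors w).symm ▸ hw x)
  obtain ⟨i, rfl⟩ := List.get_of_mem hA
  exact ⟨i, h, .inl hx⟩

theorem IsFactorCycle.active_TG_iff {Q : List (List α)} (hQ : IsFactorCycle Q) {K t : ℕ}
    {x y : α} :
    (TG (wordPow Q.flatten K)).Active t x y ↔ (wordGraph (wordPow Q.flatten K)).Adj x y ∧
      ∃ i < K * Q.length, t = i + 1 ∧ ∃ A, Q[i % Q.length]? = some A ∧ (x ∈ A ∨ y ∈ A) := by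
  rw [WordTemporal.active_TG_iff, hQ.timestepFactors_wordPow]
  refine and_congr_right fun _ => ⟨?_, ?_⟩
  · rintro ⟨i, A, rfl, hA, hmem⟩
    have hi : i < K * Q.length := length_wordPow Q K ▸ (List.getElem?_eq_some_iff.1 hA).1
    exact ⟨i, hi, rfl, A, getElem?_wordPow Q hi ▸ hA, hmem⟩
  · rintro ⟨i, hi, rfl, A, hA, hmem⟩
    exact ⟨i, A, rfl, (getElem?_wordPow Q hi).trans hA, hmem⟩

theorem IsFactorCycle.exists_active_TG {Q : List (List α)} (hQ : IsFactorCycle Q) {K r : ℕ}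
    (hr : r < K) {x y : α} (hx : x ∈ Q.flatten)
    (hxy : (wordGraph (wordPow Q.flatten K)).Adj x y) :
    ∃ t, r * Q.length < t ∧ t ≤ (r + 1) * Q.length ∧
      (TG (wordPow Q.flatten K)).Active t x y := by
  obtain ⟨A, hA, hxA⟩ := List.mem_flatten.1 hx
  obtain ⟨j, hj, hjA⟩ := List.getElem_of_mem hA
  have hle : (r + 1) * Q.length ≤ K * Q.length := Nat.mul_le_mul_right _ hr
  rw [Nat.succ_mul] at hle ⊢
  refine ⟨r * Q.length + j + 1, by omega, by omega,
    hQ.active_TG_iff.2 ⟨hxy, r * Q.length + j, by omega, rfl, A, ?_, .inl hxA⟩⟩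
  rw [Nat.mul_add_mod', Nat.mod_eq_of_lt hj, List.getElem?_eq_getElem hj, hjA]

end Factors

section Exploration

theorem exists_covering_walk {V : Type*} [Finite V] {G : SimpleGraph V} (hG : G.Preconnected)
    (u : V) : ∃ (v : V) (p : G.Walk u v), ∀ x, x ∈ p.support := by
  classical
  have := Fintype.ofFinite V
  suffices h : ∀ s : Finset V, ∃ (v : V) (p : G.Walk u v), ∀ x ∈ s, x ∈ p.support by
    simpa using h Finset.univ
  intro s
  induction s using Finset.induction_on with
  | empty => exact ⟨u, .nil, by simp⟩
  | insert a s _ ih =>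
    obtain ⟨v, p, hp⟩ := ih
    obtain ⟨q⟩ := hG v a
    refine ⟨a, p.append q, fun x hx => (p.mem_support_append_iff q).2 ?_⟩
    rcases Finset.mem_insert.1 hx with rfl | hx
    · exact .inr q.end_mem_support
    · exact .inl (hp x hx)

variable {V : Type*} {𝒢 : TemporalGraph V} {G : SimpleGraph V} {M K : ℕ}

theorem exists_isTemporalWalk_of_walk
    (hact : ∀ r < K, ∀ x y, G.Adj x y → ∃ t, r * M < t ∧ t ≤ (r + 1) * M ∧ 𝒢.Active t x y)
    {u v : V} (p : G.Walk u v) {r : ℕ} (hr : r + p.length ≤ K) :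
    ∃ P : List (WalkStep V), IsTemporalWalk 𝒢 P ∧
      (∀ s ∈ P.head?, s.src = u ∧ r * M < s.time) ∧ P.map WalkStep.dst = p.support.tail := by
  induction p generalizing r with
  | nil => exact ⟨[], ⟨by simp, .nil⟩, by simp, rfl⟩
  | @cons a b c hab p ih =>
    rw [SimpleGraph.Walk.length_cons] at hr
    obtain ⟨t, hrt, htr, ht⟩ := hact r (by omega) a b hab
    obtain ⟨P, ⟨hPact, hPchain⟩, hhead, hdst⟩ := ih (r := r + 1) (by omega)
    refine ⟨⟨a, b, t⟩ :: P, ⟨List.forall_mem_cons.2 ⟨ht, hPact⟩, List.isChain_cons.2 ⟨?_, hPchain⟩⟩,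
      by simpa using hrt, ?_⟩
    · exact fun s hs => ⟨(hhead s hs).1.symm, htr.trans_lt (hhead s hs).2⟩
    · rw [List.map_cons, hdst, SimpleGraph.Walk.support_cons, List.tail_cons,
        p.cons_tail_support]

theorem exists_isExploration_of_walk [Nontrivial V]
    (hact : ∀ r < K, ∀ x y, G.Adj x y → ∃ t, r * M < t ∧ t ≤ (r + 1) * M ∧ 𝒢.Active t x y)
    {u v : V} (p : G.Walk u v) (hp : p.length ≤ K) (hcover : ∀ x, x ∈ p.support) :
    ∃ P, IsExploration 𝒢 u P := by
  obtain ⟨P, hP, hhead, hdst⟩ := exists_isTemporalWalk_of_walk hact p (r := 0) (by omega)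
  have hvisit (x : V) (hx : x ≠ u) : ∃ s ∈ P, s.dst = x := by
    rw [← List.mem_map, hdst]
    exact (SimpleGraph.Walk.mem_support_iff p).1 (hcover x) |>.resolve_left hx
  obtain ⟨x, hx⟩ := exists_ne u
  obtain ⟨s, hs⟩ : ∃ s, s ∈ P.head? := by
    obtain ⟨s, hs, -⟩ := hvisit x hx
    exact ⟨_, List.head_mem_head? (List.ne_nil_of_mem hs)⟩
  refine ⟨P, hP, by simp [Option.mem_def.1 hs, (hhead s hs).1], fun y => ?_⟩
  rcases eq_or_ne y u with rfl | hy
  · exact ⟨s, List.mem_of_mem_head? hs, .inl (hhead s hs).1.symm⟩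
  · obtain ⟨s, hs, rfl⟩ := hvisit y hy
    exact ⟨s, hs, .inr rfl⟩

theorem IsFactorCycle.exists_forall_exists_isExploration [Finite V] [Nontrivial V] [DecidableEq V]
    {Q : List (List V)} (hQ : IsFactorCycle Q) (hmem : ∀ x, x ∈ Q.flatten)
    (hG : G.Preconnected) {K₀ : ℕ} (hK₀ : ∀ K ≥ K₀, wordGraph (wordPow Q.flatten K) = G) :
    ∃ K ≥ K₀, ∀ u, ∃ P, IsExploration (TG (wordPow Q.flatten K)) u P := by
  have := Fintype.ofFinite V
  choose v p hp using exists_covering_walk hG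
  set L := Finset.univ.sup fun u => (p u).length
  have hK := hK₀ (K₀ + L) (Nat.le_add_right ..)
  have hact : ∀ r < K₀ + L, ∀ x y, G.Adj x y → ∃ t, r * Q.length < t ∧ t ≤ (r + 1) * Q.length ∧
      (TG (wordPow Q.flatten (K₀ + L))).Active t x y :=
    fun r hr x y hxy => hQ.exists_active_TG hr (hmem x) (hK.symm ▸ hxy)
  have hlen (u : V) : (p u).length ≤ L :=
    Finset.le_sup (f := fun u => (p u).length) (Finset.mem_univ u)
  exact ⟨K₀ + L, Nat.le_add_right .., fun u =>
    exists_isExploration_of_walk hact (p u) ((hlen u).trans (Nat.le_add_left ..)) (hp u)⟩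

end Exploration

section LowerBound

variable {V : Type*} {𝒢 : TemporalGraph V} {u : V} {P : List (WalkStep V)}

theorem IsTemporalWalk.time_add_le (hP : IsTemporalWalk 𝒢 P) {a k : ℕ} (h : a + k < P.length) :
    P[a].time + k ≤ P[a + k].time := by
  induction k with
  | zero => exact le_rfl
  | succ k ih =>
    have hstep := (List.isChain_iff_getElem.1 hP.2 (a + k) h).2
    have := ih (by omega)
    simp only [← add_assoc]
    omega

theorem IsTemporalWalk.layer_src_le (hP : IsTemporalWalk 𝒢 P) {f : V → ℕ}
    (hf : ∀ t x y, 𝒢.Active t x y → f y ≤ f x + 1) {a k : ℕ} (h : a + k < P.length) :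
    f P[a + k].src ≤ f P[a].src + k := by
  induction k with
  | zero => exact le_rfl
  | succ k ih =>
    have hstep := (List.isChain_iff_getElem.1 hP.2 (a + k) h).1
    have hlayer := hf _ _ _ (hP.1 P[a + k] (List.getElem_mem _))
    rw [hstep] at hlayer
    have := ih (by omega)
    simp only [← add_assoc]
    omega

theorem IsTemporalWalk.time_pos (hP : IsTemporalWalk 𝒢 P) {s : WalkStep V} (hs : s ∈ P) :
    0 < s.time := by
  obtain ⟨i, hi, -⟩ := hP.1 s hs
  omega

theorem IsTemporalWalk.time_le_walkTime (hP : IsTemporalWalk 𝒢 P) {a : ℕ} (h : a < P.length) :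
    P[a].time ≤ walkTime P := by
  have hlast : P[a + (P.length - 1 - a)].time = walkTime P := by
    have hindex : a + (P.length - 1 - a) = P.length - 1 := by omega
    simp only [walkTime, List.getLast?_eq_getElem?, hindex]
    rw [List.getElem?_eq_getElem (by omega), Option.map_some, Option.getD_some]
  have := hP.time_add_le (a := a) (k := P.length - 1 - a) (by omega)
  omega

theorem IsTemporalWalk.length_le_walkTime (hP : IsTemporalWalk 𝒢 P) : P.length ≤ walkTime P := by
  rcases Nat.eq_zero_or_pos P.length with h | h
  · omega
  have hfirst := hP.time_pos (List.getElem_mem h)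
  have hadd := hP.time_add_le (a := 0) (k := P.length - 1) (by omega)
  have hlast := hP.time_le_walkTime (a := 0 + (P.length - 1)) (by omega)
  omega

theorem IsTemporalWalk.src_mem (hP : IsTemporalWalk 𝒢 P) (hu : P.head?.map WalkStep.src = some u)
    {s : WalkStep V} (hs : s ∈ P) : s.src ∈ u :: P.map WalkStep.dst := by
  obtain ⟨a, ha, rfl⟩ := List.getElem_of_mem hs
  cases a with
  | zero => simp_all [List.head?_eq_getElem?]
  | succ a =>
    rw [← (List.isChain_iff_getElem.1 hP.2 a ha).1]
    exact List.mem_cons_of_mem _ (List.mem_map_of_mem (List.getElem_mem _))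

theorem IsExploration.card_le [Fintype V] (hP : IsExploration 𝒢 u P) :
    Fintype.card V ≤ P.length + 1 := by
  classical
  obtain ⟨hwalk, hu, hvisit⟩ := hP
  have hcover : Finset.univ ⊆ (u :: P.map WalkStep.dst).toFinset := fun x _ => by
    rw [List.mem_toFinset]
    obtain ⟨s, hs, rfl | rfl⟩ := hvisit x
    · exact hwalk.src_mem hu hs
    · exact List.mem_cons_of_mem _ (List.mem_map_of_mem hs)
  calc Fintype.card V ≤ (u :: P.map WalkStep.dst).toFinset.card := Finset.card_le_card hcover
    _ ≤ (u :: P.map WalkStep.dst).length := List.toFinset_card_le _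
    _ = P.length + 1 := by simp

/-- The timesteps of `𝒢` come in rounds of length `M`. Edges join vertices in equal or consecutive
layers of `f`, and in all but the first timestep of a round, the `j`-th active edges (counting from
`0`) lie near layer `2 * j`. So the active region climbs twice as fast as a temporal walk can. -/
structure ClimbsInRounds (𝒢 : TemporalGraph V) (f : V → ℕ) (M : ℕ) : Prop where
  layer_le : ∀ t x y, 𝒢.Active t x y → f y ≤ f x + 1
  le_layer_src : ∀ t x y, 𝒢.Active t x y → 2 * ((t - 1) % M) ≤ f x + 3
  layer_src_le : ∀ t x y, 𝒢.Active t x y → (t - 1) % M ≠ 0 → f x ≤ 2 * ((t - 1) % M) + 2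

variable {f : V → ℕ} {M : ℕ}

theorem ClimbsInRounds.round_lt (h𝒢 : ClimbsInRounds 𝒢 f M) (hP : IsTemporalWalk 𝒢 P) {a : ℕ}
    (ha : a + 7 < P.length) : (P[a].time - 1) / M < (P[a + 7].time - 1) / M := by
  -- The edge `a` may be active in the exceptional timestep of its round. If the six edges after it
  -- are in the same round, the active layers move up by `12`, which exceeds the `6` layers climbed
  -- by the walk by more than the tolerance `5` in `ClimbsInRounds`.
  by_contra! hround
  have hact (b : ℕ) (hb : b < P.length) := hP.1 P[b] (List.getElem_mem _)
  have hpos := hP.time_pos (List.getElem_mem (n := a) (by omega))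
  have htime₁ := hP.time_add_le (a := a) (k := 1) (by omega)
  have htime₇ := hP.time_add_le (a := a + 1) (k := 6) ha
  have hlayer₁ := h𝒢.layer_src_le _ _ _ (hact (a + 1) (by omega))
  have hlayer₇ := h𝒢.le_layer_src _ _ _ (hact (a + 7) ha)
  have hclimb := hP.layer_src_le h𝒢.layer_le (a := a + 1) (k := 6) ha
  simp only [add_assoc, Nat.reduceAdd] at htime₇ hclimb
  have hmod {i j : ℕ} (hij : i ≤ j) (h : j / M ≤ i / M) : j % M = i % M + (j - i) := by
    have := Nat.div_add_mod i M
    have := Nat.div_add_mod j M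
    rw [h.antisymm (Nat.div_le_div_right hij)] at this
    omega
  have hdiv₁ : (P[a + 1].time - 1) / M ≤ (P[a].time - 1) / M :=
    (Nat.div_le_div_right (by omega)).trans hround
  have hdiv₇ : (P[a + 7].time - 1) / M ≤ (P[a + 1].time - 1) / M :=
    hround.trans (Nat.div_le_div_right (by omega))
  have hmod₁ := hmod (by omega) hdiv₁
  have hmod₇ := hmod (by omega) hdiv₇
  have := hlayer₁ (by omega)
  omega

theorem ClimbsInRounds.length_le (h𝒢 : ClimbsInRounds 𝒢 f M) (hP : IsTemporalWalk 𝒢 P) :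
    P.length ≤ 7 * ((walkTime P - 1) / M) + 7 := by
  have hround (q : ℕ) (hq : 7 * q < P.length) : q ≤ (P[7 * q].time - 1) / M := by
    induction q with
    | zero => exact Nat.zero_le _
    | succ q ih => exact (ih (by omega)).trans_lt (h𝒢.round_lt hP hq)
  by_contra! hlen
  have hlast : 7 * ((walkTime P - 1) / M + 1) < P.length := by omega
  have hle : (P[7 * ((walkTime P - 1) / M + 1)].time - 1) / M ≤ (walkTime P - 1) / M :=
    Nat.div_le_div_right (Nat.sub_le_sub_right (hP.time_le_walkTime hlast) 1)
  have := hround _ hlast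
  omega

theorem ClimbsInRounds.mul_card_le_walkTime [Fintype V] (h𝒢 : ClimbsInRounds 𝒢 f M)
    (hP : IsExploration 𝒢 u P) {d : ℕ} (hdM : d ≤ 2 * M) (hdV : d < Fintype.card V) :
    d * Fintype.card V ≤ 22 * walkTime P := by
  have hlen := h𝒢.length_le hP.1
  have hcard := hP.card_le
  have htime := hP.1.length_le_walkTime
  set q := (walkTime P - 1) / M
  have hq : M * q ≤ walkTime P := (Nat.mul_div_le _ _).trans (Nat.sub_le _ _)
  calc d * Fintype.card V ≤ d * (7 * q + 8) := by gcongr; omega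
    _ = 7 * (d * q) + 8 * d := by ring
    _ ≤ 7 * (2 * M * q) + 8 * d := by gcongr
    _ = 14 * (M * q) + 8 * d := by ring
    _ ≤ 22 * walkTime P := by omega

variable [DecidableEq V]

theorem IsFactorCycle.climbsInRounds {Q : List (List V)} (hQ : IsFactorCycle Q) {K : ℕ}
    (hadj : ∀ x y, (wordGraph (wordPow Q.flatten K)).Adj x y → f y ≤ f x + 1)
    (hlayer : ∀ j A, Q[j + 1]? = some A → ∀ x ∈ A, 2 * j ≤ f x ∧ f x ≤ 2 * j + 3) :
    ClimbsInRounds (TG (wordPow Q.flatten K)) f Q.length := by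
  have hact {t : ℕ} {x y : V} (h : (TG (wordPow Q.flatten K)).Active t x y)
      (ht : (t - 1) % Q.length ≠ 0) :
      2 * ((t - 1) % Q.length) ≤ f x + 3 ∧ f x ≤ 2 * ((t - 1) % Q.length) + 2 := by
    obtain ⟨hxy, i, -, rfl, A, hA, hmem⟩ := hQ.active_TG_iff.1 h
    rw [Nat.add_sub_cancel] at ht ⊢
    obtain ⟨j, hj⟩ := Nat.exists_eq_succ_of_ne_zero ht
    rw [hj] at hA ⊢
    have hxy' := hadj x y hxy
    have hyx' := hadj y x hxy.symm
    rcases hmem with hx | hy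
    · have := hlayer j A hA x hx
      omega
    · have := hlayer j A hA y hy
      omega
  refine ⟨fun t x y h => hadj x y (hQ.active_TG_iff.1 h).1, fun t x y h => ?_,
    fun t x y h ht => (hact h ht).2⟩
  rcases eq_or_ne ((t - 1) % Q.length) 0 with ht | ht
  · omega
  · exact (hact h ht).1

theorem IsFactorCycle.exists_word [Fintype V] [Nontrivial V] {Q : List (List V)}
    (hQ : IsFactorCycle Q) (hmem : ∀ x, x ∈ Q.flatten) {G : SimpleGraph V} (hG : G.Preconnected)
    {K₀ : ℕ} (hK₀ : 0 < K₀) (hword : ∀ K ≥ K₀, wordGraph (wordPow Q.flatten K) = G)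
    (hadj : ∀ x y, G.Adj x y → f y ≤ f x + 1)
    (hlayer : ∀ j A, Q[j + 1]? = some A → ∀ x ∈ A, 2 * j ≤ f x ∧ f x ≤ 2 * j + 3)
    {d : ℕ} (hdQ : d ≤ 2 * Q.length) (hdV : d < Fintype.card V) :
    ∃ v : List V, (∀ x, x ∈ v) ∧ (TG v).underlying = G ∧ (∀ u, ∃ P, IsExploration (TG v) u P) ∧
      ∀ u P, IsExploration (TG v) u P → d * Fintype.card V ≤ 22 * walkTime P := by
  obtain ⟨K, hK, hexpl⟩ := hQ.exists_forall_exists_isExploration hmem hG hword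
  have hmemK (x : V) : x ∈ wordPow Q.flatten K := (mem_wordPow (by omega)).2 (hmem x)
  have hclimb := hQ.climbsInRounds (K := K) (by rwa [hword K hK]) hlayer
  exact ⟨wordPow Q.flatten K, hmemK, (underlying_TG hmemK).trans (hword K hK), hexpl,
    fun u P hP => hclimb.mul_card_le_walkTime hP hdQ hdV⟩

end LowerBound

section LayeredGraph

theorem exists_walk_length_eq_sub {V : Type*} {f : V → ℕ} {x y : V}
    (hsurj : ∀ j ≤ f y, ∃ z, f z = j) (hxy : f x < f y) :
    ∃ p : (layeredGraph f).Walk x y, p.length = f y - f x := by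
  obtain ⟨k, hk⟩ := Nat.exists_eq_add_of_lt hxy
  induction k generalizing x with
  | zero => exact ⟨.cons (layeredGraph_adj.2 (.inl hk.symm)) .nil, by simp [hk]⟩
  | succ k ih =>
    obtain ⟨z, hz⟩ := hsurj (f x + 1) (by omega)
    obtain ⟨p, hp⟩ := ih (x := z) (by omega) (by omega)
    exact ⟨.cons (layeredGraph_adj.2 (.inl hz.symm)) p, by rw [SimpleGraph.Walk.length_cons]; omega⟩

theorem layer_le_add_length {V : Type*} {f : V → ℕ} {x y : V} (p : (layeredGraph f).Walk x y) :
    f y ≤ f x + p.length := by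
  induction p with
  | nil => exact le_rfl
  | cons h p ih =>
    rw [layeredGraph_adj] at h
    rw [SimpleGraph.Walk.length_cons]
    omega

variable {V : Type*} {d : ℕ} {layer : V → Fin (d + 1)}

theorem edist_layeredGraph_le (hd : 2 ≤ d) (hlayer : Function.Surjective layer) (x y : V) :
    (layeredGraph fun z => (layer z : ℕ)).edist x y ≤ d := by
  have hsurj (j : ℕ) (hj : j ≤ d) : ∃ z, (layer z : ℕ) = j :=
    (hlayer ⟨j, Nat.lt_succ_of_le hj⟩).imp fun z hz => congrArg Fin.val hz
  wlog hxy : (layer x : ℕ) ≤ layer y generalizing x y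
  · rw [SimpleGraph.edist_comm]
    exact this y x (by omega)
  suffices h : ∃ p : (layeredGraph fun z => (layer z : ℕ)).Walk x y, p.length ≤ d by
    obtain ⟨p, hp⟩ := h
    exact (SimpleGraph.edist_le p).trans (by exact_mod_cast hp)
  have hy : (layer y : ℕ) ≤ d := by omega
  rcases hxy.lt_or_eq with hlt | heq
  · obtain ⟨p, hp⟩ := exists_walk_length_eq_sub (fun j hj => hsurj j (hj.trans hy)) hlt
    exact ⟨p, by omega⟩
  · obtain ⟨z, hz⟩ : ∃ z, (layer x : ℕ) + 1 = layer z ∨ (layer z : ℕ) + 1 = layer x := by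
      rcases Nat.eq_zero_or_pos (layer x) with h | h
      · exact (hsurj (layer x + 1) (by omega)).imp fun z hz => .inl hz.symm
      · exact (hsurj (layer x - 1) (by omega)).imp fun z hz => .inr (by omega)
    exact ⟨.cons (layeredGraph_adj.2 hz) (.cons (layeredGraph_adj.2 (by omega)) .nil), by simpa⟩

theorem ediam_layeredGraph (hd : 2 ≤ d) (hlayer : Function.Surjective layer) :
    (layeredGraph fun x => (layer x : ℕ)).ediam = d := by
  refine (SimpleGraph.ediam_le_of_edist_le (edist_layeredGraph_le hd hlayer)).antisymm ?_
  obtain ⟨x, hx⟩ := hlayer 0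
  obtain ⟨y, hy⟩ := hlayer (Fin.last d)
  refine le_trans (le_iInf fun p => ?_) (SimpleGraph.edist_le_ediam (u := x) (v := y))
  have := layer_le_add_length p
  simp only [hx, hy, Fin.val_last, Fin.val_zero, zero_add] at this
  exact_mod_cast this

theorem preconnected_layeredGraph (hd : 2 ≤ d) (hlayer : Function.Surjective layer) :
    (layeredGraph fun x => (layer x : ℕ)).Preconnected := by
  have : Nonempty V := (hlayer 0).nonempty
  exact SimpleGraph.preconnected_of_ediam_ne_top
    (by rw [ediam_layeredGraph hd hlayer]; exact ENat.natCast_ne_top d)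

end LayeredGraph

section SlowWords

theorem forcesBreak_of_reverse_prefix {α : Type*} {l A B : List α} (hl : l ≠ []) (hA : l ⊆ A)
    (hB : l.reverse <+: B) : ForcesBreak A B := by
  obtain ⟨s, rfl⟩ := hB
  refine ⟨l.getLast hl, hA (List.getLast_mem hl), ?_⟩
  rw [List.head?_append, List.head?_reverse, List.getLast?_eq_some_getLast hl, Option.some_or]

theorem reverse_prefix_sweepBlock {α : Type*} (F : ℕ → List α) (k : ℕ) :
    (F (2 * k)).reverse <+: sweepBlock F k :=
  ⟨F (2 * k + 2) ++ (F (2 * k + 1)).reverse ++ F (2 * k + 3), by simp [sweepBlock]⟩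

theorem subset_sweepBlock {α : Type*} (F : ℕ → List α) (k : ℕ) :
    F (2 * k + 2) ⊆ sweepBlock F k := by
  intro a ha
  simp [sweepBlock, ha]

theorem isFactorCycle_sweepFactors {α : Type*} {F : ℕ → List α} {m : ℕ} (hm : m ≠ 0)
    (hnodup : ∀ A ∈ sweepFactors F m, A.Nodup) (hF : ∀ k ≤ m, F (2 * k) ≠ []) :
    IsFactorCycle (sweepFactors F m) := by
  obtain ⟨m, rfl⟩ := Nat.exists_eq_succ_of_ne_zero hm
  refine ⟨hnodup, List.isChain_cons.2 ⟨?_, ?_⟩, ?_⟩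
  · simp only [List.range_succ_eq_map, List.map_cons, List.head?_cons, Option.mem_some, forall_eq']
    exact forcesBreak_of_reverse_prefix (hF 0 (Nat.zero_le _))
      (List.subset_append_of_subset_right _ (List.subset_append_left ..))
      (reverse_prefix_sweepBlock F 0)
  · rw [List.isChain_map, List.isChain_range]
    exact fun k hk => forcesBreak_of_reverse_prefix (hF (k + 1) (by omega))
      (subset_sweepBlock F k) (reverse_prefix_sweepBlock F (k + 1))
  · simp only [sweepFactors, List.range_succ, List.map_append, List.map_singleton,
      ← List.cons_append, List.getLast?_concat, List.head?_append, List.head?_cons, Option.some_or,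
      Option.mem_some, forall_eq']
    exact forcesBreak_of_reverse_prefix (hF (m + 1) le_rfl) (subset_sweepBlock F m)
      ((reverse_prefix_sweepBlock F (m + 1)).trans (List.prefix_append ..))

variable {V : Type*} [Fintype V]

theorem nodup_of_mem_sweepFactors_layerList {f : V → ℕ} {m : ℕ} (hm : m ≠ 0) {A : List V}
    (hA : A ∈ sweepFactors (layerList f) m) : A.Nodup := by
  have hblock (k : ℕ) : (sweepBlock (layerList f) k).Nodup := by
    simp only [sweepBlock, List.nodup_append, List.nodup_reverse, nodup_layerList, List.mem_append,
      List.mem_reverse, mem_layerList]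
    grind
  rcases List.mem_cons.1 hA with rfl | hA
  · simp only [List.nodup_append, List.nodup_reverse, nodup_layerList, sweepBlock, List.mem_append,
      List.mem_reverse, mem_layerList]
    grind
  · obtain ⟨k, -, rfl⟩ := List.mem_map.1 hA
    exact hblock k

theorem layer_bounds_of_mem_sweepFactors {f : V → ℕ} {m j : ℕ} {A : List V}
    (hA : (sweepFactors (layerList f) m)[j + 1]? = some A) {x : V} (hx : x ∈ A) :
    2 * j ≤ f x ∧ f x ≤ 2 * j + 3 := by
  simp only [sweepFactors, List.getElem?_cons_succ, List.getElem?_map,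
    Option.map_eq_some_iff] at hA
  obtain ⟨k, hk, rfl⟩ := hA
  have hkj : j = k := by
    obtain ⟨hj, h⟩ := List.getElem?_eq_some_iff.1 hk
    rwa [List.getElem_range] at h
  simp only [sweepBlock, List.mem_append, List.mem_reverse, mem_layerList] at hx
  omega

variable [DecidableEq V]

theorem exists_word_layeredGraph {d : ℕ} {layer : V → Fin (d + 1)} (hd : 2 ≤ d)
    (hlayer : Function.Surjective layer) :
    ∃ v : List V, (∀ x, x ∈ v) ∧ (TG v).underlying = (layeredGraph fun x => (layer x : ℕ)) ∧
      (∀ u, ∃ P, IsExploration (TG v) u P) ∧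
      ∀ u P, IsExploration (TG v) u P → d * Fintype.card V ≤ 22 * walkTime P := by
  have hcard : d < Fintype.card V := by simpa using Fintype.card_le_of_surjective layer hlayer
  have : Nontrivial V := Fintype.one_lt_card_iff_nontrivial.1 (by omega)
  have hle (x : V) : (layer x : ℕ) ≤ 2 * (d / 2) + 1 := by omega
  have hne (k : ℕ) (hk : k ≤ d / 2) : layerList (fun x => (layer x : ℕ)) (2 * k) ≠ [] := by
    obtain ⟨x, hx⟩ := hlayer ⟨2 * k, by omega⟩
    exact List.ne_nil_of_mem (mem_layerList.2 (congrArg Fin.val hx))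
  have hcycle := isFactorCycle_sweepFactors (by omega)
    (fun A => nodup_of_mem_sweepFactors_layerList (by omega)) hne
  refine hcycle.exists_word (mem_layerWord hle) (preconnected_layeredGraph hd hlayer) two_pos
    (fun K hK => wordGraph_layerWord hle hK) (f := fun x => (layer x : ℕ)) (fun x y hxy => ?_)
    (fun j A hA x hx => layer_bounds_of_mem_sweepFactors hA hx) ?_ hcard
  · rw [layeredGraph_adj] at hxy
    omega
  · simp only [sweepFactors, List.length_cons, List.length_map, List.length_range]
    omega

theorem wordGraph_wordPow_univ (K : ℕ) :
    wordGraph (wordPow (Finset.univ : Finset V).toList K) = ⊤ := by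
  ext x y
  refine ⟨fun h => h.1, fun hxy => ⟨hxy, alternate_wordPow (j := 1) ?_ K⟩⟩
  simpa [wordPow] using proj_pair_eq_or hxy Finset.univ.nodup_toList
    (Finset.mem_toList.2 (Finset.mem_univ x)) (Finset.mem_toList.2 (Finset.mem_univ y))

theorem exists_word_top [Nontrivial V] :
    ∃ v : List V, (∀ x, x ∈ v) ∧ (TG v).underlying = ⊤ ∧
      (∀ u, ∃ P, IsExploration (TG v) u P) ∧
      ∀ u P, IsExploration (TG v) u P → Fintype.card V ≤ 22 * walkTime P := by
  have hne : (Finset.univ : Finset V).toList ≠ [] := by simp [Finset.univ_nonempty.ne_empty]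
  have hcycle : IsFactorCycle [(Finset.univ : Finset V).toList] := by
    refine ⟨by simpa using Finset.nodup_toList _, .singleton _, ?_⟩
    simp only [List.getLast?_singleton, List.head?_cons, Option.mem_some, forall_eq']
    exact ⟨_, List.head_mem hne, List.head?_eq_some_head hne⟩
  simpa using hcycle.exists_word (by simp) SimpleGraph.preconnected_top one_pos
    (fun K _ => by simpa using wordGraph_wordPow_univ K) (f := fun _ => 0) (by simp) (by simp)
    (d := 1) (by simp) Fintype.one_lt_card

end SlowWords

theorem card_filter_mod_eq_bounds {n r j : ℕ} (hj : j < r) :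
    n / r ≤ (Finset.univ.filter fun x : Fin n => (x : ℕ) % r = j).card ∧
      (Finset.univ.filter fun x : Fin n => (x : ℕ) % r = j).card ≤ n / r + 1 := by
  have hcount : (Finset.univ.filter fun x : Fin n => (x : ℕ) % r = j).card =
      n.count (· ≡ j [MOD r]) := by
    have hj' : j % r = j := Nat.mod_eq_of_lt hj
    rw [Nat.count_eq_card_filter_range]
    refine Finset.card_nbij Fin.val (fun x hx => ?_) Fin.val_injective.injOn fun y hy => ?_
    · simpa [Nat.ModEq, hj'] using hx
    · have hy : y < n ∧ y % r = j := by simpa [Nat.ModEq, hj'] using hy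
      exact ⟨⟨y, hy.1⟩, by simpa using hy.2, rfl⟩
  rw [hcount, Nat.count_modEq_card _ (by omega)]
  split_ifs <;> omega

end WordTemporal

/-- There is an absolute constant `c > 0` such that for all `1 ≤ d < n` some word `v` over an
alphabet of `n` symbols, each of which occurs in `v`, represents a temporal graph `TG(v)` whose
underlying graph has diameter `d`, which can be explored from every start vertex, and every
exploration of which requires at least `c d n` timesteps. For `d ≥ 2` the underlying graph
moreover consists of `d + 1` layers of (up to rounding) equal size, two vertices being adjacent
exactly if they lie in consecutive layers. -/
theorem mainTheorem4 :
    ∃ c : ℝ, 0 < c ∧ ∀ n d : ℕ, 1 ≤ d → d < n →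
      ∃ v : List (Fin n),
        (∀ x : Fin n, x ∈ v) ∧
        (WordTemporal.TG v).underlying.ediam = (d : ℕ∞) ∧
        (∀ u : Fin n, ∃ P : List (WordTemporal.WalkStep (Fin n)),
          WordTemporal.IsExploration (WordTemporal.TG v) u P) ∧
        (∀ (u : Fin n) (P : List (WordTemporal.WalkStep (Fin n))),
          WordTemporal.IsExploration (WordTemporal.TG v) u P →
            c * (d : ℝ) * (n : ℝ) ≤ (WordTemporal.walkTime P : ℝ)) ∧
        (2 ≤ d → ∃ layer : Fin n → Fin (d + 1),
          (∀ x y : Fin n, (WordTemporal.TG v).underlying.Adj x y ↔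
            ((layer x : ℕ) + 1 = (layer y : ℕ) ∨ (layer y : ℕ) + 1 = (layer x : ℕ))) ∧
          (∀ j : Fin (d + 1),
            n / (d + 1) ≤ (Finset.univ.filter (fun x : Fin n => layer x = j)).card ∧
            (Finset.univ.filter (fun x : Fin n => layer x = j)).card ≤ n / (d + 1) + 1)) := by
  have cast_bound {n d T : ℕ} (h : d * n ≤ 22 * T) : (1 / 22 : ℝ) * d * n ≤ T := by
    have h' : (d : ℝ) * n ≤ 22 * T := by exact_mod_cast h
    linarith
  refine ⟨1 / 22, by norm_num, fun n d hd hdn => ?_⟩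
  rcases hd.eq_or_lt with rfl | hd
  · have : Nontrivial (Fin n) := Fin.nontrivial_iff_two_le.2 hdn
    obtain ⟨v, hmem, hunder, hexpl, htime⟩ := WordTemporal.exists_word_top (V := Fin n)
    refine ⟨v, hmem, ?_, hexpl, fun u P hP => cast_bound ?_, by omega⟩
    · rw [hunder, SimpleGraph.ediam_top, Nat.cast_one]
    · simpa using htime u P hP
  · let layer (x : Fin n) : Fin (d + 1) := ⟨x % (d + 1), Nat.mod_lt _ d.succ_pos⟩
    have hlayer : Function.Surjective layer := fun j =>
      ⟨⟨j, j.is_le.trans_lt hdn⟩, Fin.ext (Nat.mod_eq_of_lt j.is_lt)⟩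
    obtain ⟨v, hmem, hunder, hexpl, htime⟩ := WordTemporal.exists_word_layeredGraph hd hlayer
    refine ⟨v, hmem, ?_, hexpl, fun u P hP => cast_bound ?_, fun _ =>
      ⟨layer, fun x y => ?_, fun j => ?_⟩⟩
    · rw [hunder, WordTemporal.ediam_layeredGraph hd hlayer]
    · simpa using htime u P hP
    · rw [hunder, WordTemporal.layeredGraph_adj]
    · simpa only [Fin.ext_iff] using WordTemporal.card_filter_mod_eq_bounds j.is_lt
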